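/- Write $(a;q)_n=\prod_{j=0}^{n-1}(1-aq^j)$, $(a;q)_\infty=\prod_{j\ge 0}(1-aq^j)$ and $(a_1,\dots,a_s;q)_\infty=(a_1;q)_\infty\cdots(a_s;q)_\infty$, and read $1/(q;q)_m$ as $0$ for $m<0$. The following three identities hold, both for every complex number $q$ with $|q|<1$ (the double series converging absolutely) and as identities of formal power series in $q$ with integer coefficients: $$\sum_{n,r\ge 0}\frac{q^{n^2+2r^2}}{(q;q^2)_n\,(q^2;q^2)_r\,(q^2;q^4)_r\,(q;q)_{n-2r}}=\frac{(q^{28},q^{32},q^{60};q^{60})_\infty}{(q;q)_\infty},$$ $$\sum_{n,r\ge 0}\frac{q^{n^2+2r^2+4n+4r}}{(q;q^2)_{n+2}\,(q^2;q^2)_r\,(q^2;q^4)_{r+1}\,(q;q)_{n-2r}}=\frac{(q^{4},q^{56},q^{60};q^{60})_\infty}{(q;q)_\infty},$$ $$\sum_{n,r\ge 0}\frac{q^{n^2+4r^2}\,(-q;q^2)_n}{(q^2;q^4)_n\,(q^4;q^4)_r\,(q^4;q^8)_r\,(q^2;q^2)_{n-2r}}=\frac{(q^{40},q^{48},q^{88};q^{88})_\infty\,(-q;q^2)_\infty}{(q^2;q^2)_\infty}.$$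 -/

import Mathlib

open scoped PowerSeries PowerSeries.WithPiTopology

/-- The finite rising `q`-factorial `(a;q)_n = ∏_{j=0}^{n-1} (1 - a q^j)`. -/
def qPoch {R : Type*} [CommRing R] (a q : R) (n : ℕ) : R :=
  ∏ j ∈ Finset.range n, (1 - a * q ^ j)

/-- The infinite rising `q`-factorial `(a;q)_∞ = ∏_{j≥0} (1 - a q^j)`, the product being taken in
the topology of `R` (for power series over `ℤ`: coefficientwise stabilisation). -/
noncomputable def qPochInf {R : Type*} [CommRing R] [TopologicalSpace R] (a q : R) : R :=
  ∏' j : ℕ, (1 - a * q ^ j)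

/-- `1/(a;q)_{n-m}` with integer index `n - m`, which is read as `0` when `n - m < 0`
(used only for `a = q`, where this is the usual convention).
`Ring.inverse` is the inverse of a unit. -/
noncomputable def qPochInvSub {R : Type*} [CommRing R] (a q : R) (n m : ℕ) : R :=
  if m ≤ n then Ring.inverse (qPoch a q (n - m)) else 0

/-! ### Finite q-factorials and three terminating q-sums. -/

section Algebra

variable {R : Type*} [CommRing R]

/-! The proof iterates Bailey-type lemmas in bilateral form. A pair in base `q` relative to `a = q ^
m` is a family satisfying `β n = ∑ k, a k / ((q;q)_{n - s k} (q;q)_{n + s k + m})`, with `k` running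
over the integers. The starting point is the unit pair, `β n = 1` if `n = 0` and `0` otherwise. It
is the finite Jacobi triple product at `z = 1` (`QUnits.hasSum_thetaTerm_one`).

`QUnits.hasSum_lift_sq` turns a pair in base `q²` into one in base `q`, doubling both `s` and `m`,
so that `a` stays fixed. Applied to the unit pair in base `q⁴` it gives a `β` in closed form in base
`q²`. Applied again it gives a pair in base `q` whose `β n` is the inner sum over `r` of the first
two identities. The third uses the same construction with `q²` in place of `q`.

A last step of the ordinary Bailey lemma (`QUnits.hasSum_lift`, or `QUnits.hasSum_lift_neg` for
modulus 88) produces the sum over `n`, truncated by `1/(p;p)_{N-n}` with `p = q` or `p = q²`. As `N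
→ ∞`, dominated convergence gives the double series times `1/(p;p)_∞` on one side, and a theta
series times `1/(p;p)_∞²` on the other (times `(-q;q²)_∞` for modulus 88). The triple product
evaluates the theta series.

Each lift is an interchange of summations followed by a q-Chu–Vandermonde type sum. All limits are
taken in a `QSeriesRing`, so one argument serves both ℂ and ℤ⟦X⟧. -/

theorem qPoch_zero (a q : R) : qPoch a q 0 = 1 := by simp [qPoch]

theorem qPoch_succ (a q : R) (n : ℕ) : qPoch a q (n + 1) = qPoch a q n * (1 - a * q ^ n) := by
  simp [qPoch, Finset.prod_range_succ]

/-- `1/(q;q)_k` for an integer `k`, read as `0` when `k < 0`. -/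
noncomputable def qInv (q : R) (k : ℤ) : R :=
  if 0 ≤ k then Ring.inverse (qPoch q q k.toNat) else 0

theorem qInv_natCast (q : R) (n : ℕ) : qInv q n = Ring.inverse (qPoch q q n) := by
  simp [qInv]

theorem qInv_of_neg (q : R) {k : ℤ} (hk : k < 0) : qInv q k = 0 := by
  simp [qInv, not_le.mpr hk]

theorem qInv_zero (q : R) : qInv q 0 = 1 := by
  simp [qInv, qPoch_zero]

theorem qPochInvSub_eq_qInv (q : R) (n m : ℕ) : qPochInvSub q q n m = qInv q (n - m) := by
  unfold qPochInvSub
  split_ifs with h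
  · rw [← Nat.cast_sub h, qInv_natCast]
  · rw [qInv_of_neg]
    omega

/-- All the factors `1 - q ^ k` with `k > 0` are invertible. -/
def QUnits (q : R) : Prop := ∀ k : ℕ, 0 < k → IsUnit (1 - q ^ k)

theorem QUnits.pow {q : R} (hq : QUnits q) {k : ℕ} (hk : 0 < k) : QUnits (q ^ k) := fun j hj => by
  rw [← pow_mul]
  exact hq _ (Nat.mul_pos hk hj)

theorem QUnits.isUnit_qPoch {q : R} (hq : QUnits q) (n : ℕ) : IsUnit (qPoch q q n) := by
  induction n with
  | zero => simp [qPoch_zero]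
  | succ n ih =>
    rw [qPoch_succ, ← pow_succ']
    exact ih.mul (hq _ n.succ_pos)

/-- Valid at every integer `k`: at `k = 0` the factor `1 - q ^ 0` vanishes, in agreement with
`1/(q;q)_{-1} = 0`. This lets the recurrences below hold at the boundary of summation. -/
theorem QUnits.one_sub_mul_qInv {q : R} (hq : QUnits q) (k : ℤ) :
    (1 - q ^ k.toNat) * qInv q k = qInv q (k - 1) := by
  rcases lt_trichotomy k 0 with hk | rfl | hk
  · rw [qInv_of_neg q hk, qInv_of_neg q (by omega), mul_zero]
  · rw [qInv_of_neg q (k := 0 - 1) (by omega)]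
    simp
  · obtain ⟨n, rfl⟩ : ∃ n : ℕ, k = n + 1 := ⟨(k - 1).toNat, by omega⟩
    have h1 := hq.isUnit_qPoch n
    have h2 := hq.isUnit_qPoch (n + 1)
    rw [add_sub_cancel_right, ← Nat.cast_succ, qInv_natCast, qInv_natCast, Int.toNat_natCast]
    apply h2.mul_left_cancel
    rw [mul_left_comm, Ring.mul_inverse_cancel _ h2, Nat.succ_eq_add_one, qPoch_succ, ← pow_succ',
      mul_right_comm, Ring.mul_inverse_cancel _ h1]
    ring

theorem QUnits.qInv_pred {q : R} (hq : QUnits q) {k : ℤ} (n : ℕ) (h : k = n) :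
    qInv q (k - 1) = (1 - q ^ n) * qInv q k := by
  subst h
  rw [← hq.one_sub_mul_qInv, Int.toNat_natCast]

theorem QUnits.qPoch_mul_qInv {q : R} (hq : QUnits q) (n : ℕ) : qPoch q q n * qInv q n = 1 := by
  rw [qInv_natCast, Ring.mul_inverse_cancel _ (hq.isUnit_qPoch n)]

theorem qPoch_mul_qPoch_sq (q : R) (n : ℕ) :
    qPoch q (q ^ 2) n * qPoch (q ^ 2) (q ^ 2) n = qPoch q q (2 * n) := by
  induction n with
  | zero => simp [qPoch_zero]
  | succ n ih =>
    rw [qPoch_succ, qPoch_succ, show 2 * (n + 1) = 2 * n + 1 + 1 by ring, qPoch_succ,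
      qPoch_succ, ← ih]
    ring

theorem QUnits.isUnit_qPoch_sq {q : R} (hq : QUnits q) (n : ℕ) : IsUnit (qPoch q (q ^ 2) n) :=
  isUnit_of_mul_isUnit_left (qPoch_mul_qPoch_sq q n ▸ hq.isUnit_qPoch (2 * n))

theorem QUnits.inverse_qPoch_sq {q : R} (hq : QUnits q) (n : ℕ) :
    Ring.inverse (qPoch q (q ^ 2) n) = qInv q (2 * n : ℕ) * qPoch (q ^ 2) (q ^ 2) n := by
  rw [qInv_natCast, ← qPoch_mul_qPoch_sq, Ring.mul_inverse_rev, mul_right_comm,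
    Ring.inverse_mul_cancel _ ((hq.pow two_pos).isUnit_qPoch n), one_mul]

/-- A limiting case of q-Chu–Vandermonde. The proof is by creative telescoping: both sides satisfy
the same first-order recurrence in `N`. -/
theorem QUnits.sum_qInv_mul_qInv_mul_qInv {q : R} (hq : QUnits q) (M N T : ℕ) (hT : N < T) :
    ∑ t ∈ Finset.range T, q ^ (t ^ 2 + M * t) * qInv q t * qInv q (t + M) * qInv q (N - t)
      = qInv q N * qInv q (N + M) := by
  induction N with
  | zero =>
    rw [Finset.sum_eq_single_of_mem 0 (by simpa using hT)]
    · simp [qInv_zero]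
    · intro t _ ht
      rw [qInv_of_neg q (k := ((0 : ℕ) : ℤ) - t) (by omega), mul_zero]
  | succ N ih =>
    have ih := ih (by omega)
    -- The telescoping certificate. It vanishes at `t = 0` through `1/(q;q)_{-1}` and at `t = T`
    -- through `1/(q;q)_{N+1-T}`.
    set G : ℕ → R := fun t => -(q ^ ((N + 1 - t : ℤ)).toNat * q ^ (t ^ 2 + M * t) *
      qInv q (t - 1) * qInv q (t + M - 1) * qInv q (N + 1 - t)) with hG
    have key : (1 - q ^ (N + 1)) * (1 - q ^ (N + 1 + M)) *
        (∑ t ∈ Finset.range T, q ^ (t ^ 2 + M * t) * qInv q t * qInv q (t + M) *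
          qInv q ((N + 1 : ℕ) - t)) -
        ∑ t ∈ Finset.range T, q ^ (t ^ 2 + M * t) * qInv q t * qInv q (t + M) * qInv q (N - t)
        = G T - G 0 := by
      rw [← Finset.sum_range_sub, Finset.mul_sum, ← Finset.sum_sub_distrib]
      refine Finset.sum_congr rfl fun t _ => ?_
      simp only [hG]
      push_cast
      rcases lt_or_ge (N + 1) t with h | h
      · rw [qInv_of_neg q (k := (N + 1 - t : ℤ)) (by omega),
          qInv_of_neg q (k := (N - t : ℤ)) (by omega),
          qInv_of_neg q (k := (N + 1 - (t + 1) : ℤ)) (by omega)]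
        ring
      · obtain ⟨j, hj⟩ := Nat.exists_eq_add_of_le h
        rw [hj, show (N + 1 - (t + 1) : ℤ) = N + 1 - t - 1 by ring,
          show (N - t : ℤ) = N + 1 - t - 1 by ring,
          show (t + 1 + M - 1 : ℤ) = t + M by ring, add_sub_cancel_right,
          hq.qInv_pred j (k := (N + 1 - t : ℤ)) (by omega), hq.qInv_pred t rfl,
          hq.qInv_pred (t + M) (by push_cast; rfl)]
        rcases j with _ | j
        · rw [show (N + 1 - t : ℤ).toNat = 0 by omega]
          ring
        · rw [show (N + 1 - t : ℤ).toNat = j + 1 by omega,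
            show (N + 1 - t - 1 : ℤ).toNat = j by omega]
          ring
    rw [ih] at key
    have h0 : G T - G 0 = 0 := by
      simp only [hG]
      rw [qInv_of_neg q (k := (N + 1 - T : ℤ)) (by omega),
        qInv_of_neg q (k := ((0 : ℕ) - 1 : ℤ)) (by omega)]
      ring
    rw [h0, sub_eq_zero] at key
    apply ((hq (N + 1) (by omega)).mul (hq (N + 1 + M) (by omega))).mul_left_cancel
    rw [key, show (N : ℤ) = (N + 1 : ℕ) - 1 by push_cast; ring,
      show (((N + 1 : ℕ) : ℤ) - 1 + M) = (N + 1 : ℕ) + M - 1 by ring,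
      hq.qInv_pred (N + 1) rfl, hq.qInv_pred (N + 1 + M) (by push_cast; ring)]
    push_cast
    ring

/-- Since `(q;q)_N / (q;q)_{N-2t}` is, up to a power of `q`, `(q^{-N};q²)_t (q^{1-N};q²)_t`, this is
a q-Chu–Vandermonde sum in base `q²`. It is again proved by telescoping. -/
theorem QUnits.sum_qInv_sq_mul_qInv_sq_mul_qInv {q : R} (hq : QUnits q) (M N T : ℕ) (hT : N < T) :
    ∑ t ∈ Finset.range T, q ^ (2 * t ^ 2 + 2 * M * t) * qInv (q ^ 2) t * qInv (q ^ 2) (t + M) *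
        qInv q (N - 2 * t)
      = qPoch q (q ^ 2) (N + M) * qInv q N * qInv q (N + 2 * M) := by
  have hq2 := hq.pow two_pos
  induction N with
  | zero =>
    rw [Finset.sum_eq_single_of_mem 0 (by simpa using hT)]
    · have h1 := qPoch_mul_qPoch_sq q M
      have h2 := hq.qPoch_mul_qInv (2 * M)
      have h3 := hq2.qPoch_mul_qInv M
      rw [← h1] at h2
      push_cast at h2 ⊢
      simp only [qInv_zero, zero_add, mul_zero, mul_one, one_mul, pow_zero]
      linear_combination (-qInv (q ^ 2) M) * h2 + qPoch q (q ^ 2) M * qInv q (2 * M) * h3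
    · intro t _ ht
      rw [qInv_of_neg q (k := ((0 : ℕ) : ℤ) - 2 * t) (by omega), mul_zero]
  | succ N ih =>
    have ih := ih (by omega)
    set G : ℕ → R := fun t => -(q ^ ((N + 1 - 2 * t : ℤ)).toNat * q ^ (2 * t ^ 2 + 2 * M * t) *
      qInv (q ^ 2) (t - 1) * qInv (q ^ 2) (t + M - 1) * qInv q (N + 1 - 2 * t)) with hG
    have key : (1 - q ^ (N + 1)) * (1 - q ^ (N + 1 + 2 * M)) *
        (∑ t ∈ Finset.range T, q ^ (2 * t ^ 2 + 2 * M * t) * qInv (q ^ 2) t *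
          qInv (q ^ 2) (t + M) * qInv q ((N + 1 : ℕ) - 2 * t)) -
        (1 - q ^ (2 * (N + M) + 1)) *
        ∑ t ∈ Finset.range T, q ^ (2 * t ^ 2 + 2 * M * t) * qInv (q ^ 2) t *
          qInv (q ^ 2) (t + M) * qInv q (N - 2 * t)
        = G T - G 0 := by
      rw [← Finset.sum_range_sub, Finset.mul_sum, Finset.mul_sum, ← Finset.sum_sub_distrib]
      refine Finset.sum_congr rfl fun t _ => ?_
      simp only [hG]
      push_cast
      rcases lt_or_ge (N + 1) (2 * t) with h | h
      · rw [qInv_of_neg q (k := (N + 1 - 2 * t : ℤ)) (by omega),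
          qInv_of_neg q (k := (N - 2 * t : ℤ)) (by omega),
          qInv_of_neg q (k := (N + 1 - 2 * (t + 1) : ℤ)) (by omega)]
        ring
      · obtain ⟨j, hj⟩ := Nat.exists_eq_add_of_le h
        rw [hj, show 2 * (N + M) + 1 = (N + 1) + N + 2 * M by ring, hj,
          show (N - 2 * t : ℤ) = N + 1 - 2 * t - 1 by ring,
          show (t + 1 + M - 1 : ℤ) = t + M by ring, add_sub_cancel_right,
          hq.qInv_pred j (k := (N + 1 - 2 * t : ℤ)) (by omega), hq2.qInv_pred t rfl,
          hq2.qInv_pred (t + M) (by push_cast; rfl)]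
        rcases j with _ | j
        · rw [qInv_of_neg q (k := (N + 1 - 2 * (t + 1) : ℤ)) (by omega),
            show (N + 1 - 2 * t : ℤ).toNat = 0 by omega]
          ring
        · rw [show (N + 1 - 2 * (t + 1) : ℤ) = N + 1 - 2 * t - 1 - 1 by ring,
            hq.qInv_pred j (k := (N + 1 - 2 * t - 1 : ℤ)) (by omega),
            hq.qInv_pred (j + 1) (k := (N + 1 - 2 * t : ℤ)) (by omega),
            show (N + 1 - 2 * t : ℤ).toNat = j + 1 by omega, show N = 2 * t + j by omega]
          -- The reindexed certificate carries `1/(q;q)_{j-1}`; at `j = 0` the factor `1 - q ^ 0`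
          -- annihilates it, so the truncated exponent is harmless.
          rcases j with _ | j
          · ring
          · rw [show (((2 * t + (j + 1) : ℕ) : ℤ) + 1 - 2 * t - 1 - 1).toNat = j by omega]
            ring
    rw [ih] at key
    have h0 : G T - G 0 = 0 := by
      simp only [hG]
      rw [qInv_of_neg q (k := (N + 1 - 2 * T : ℤ)) (by omega),
        qInv_of_neg (q ^ 2) (k := ((0 : ℕ) - 1 : ℤ)) (by omega)]
      ring
    rw [h0, sub_eq_zero] at key
    apply ((hq (N + 1) (by omega)).mul (hq (N + 1 + 2 * M) (by omega))).mul_left_cancel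
    rw [key, show (N : ℤ) = (N + 1 : ℕ) - 1 by push_cast; ring,
      show (((N + 1 : ℕ) : ℤ) - 1 + 2 * M) = (N + 1 : ℕ) + 2 * M - 1 by ring,
      hq.qInv_pred (N + 1) rfl, hq.qInv_pred (N + 1 + 2 * M) (by push_cast; ring),
      show N + 1 + M = N + M + 1 by ring, qPoch_succ]
    push_cast
    ring

/-- q-Chu–Vandermonde in base `q²` with numerator parameters `q^{-2N}` and `-q^{2s+1}` and
denominator parameter `q^{4s+2}`. -/
theorem QUnits.sum_qPoch_neg_mul_qInv {q : R} (hq : QUnits q) (s N T : ℕ) (hT : N < T) :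
    ∑ t ∈ Finset.range T, q ^ (t ^ 2 + 2 * s * t) * qPoch (-q) (q ^ 2) (s + t) * qInv (q ^ 2) t *
        qInv (q ^ 2) (t + 2 * s) * qInv (q ^ 2) (N - t)
      = qPoch (-q) (q ^ 2) (s + N) * qInv (q ^ 2) N * qInv (q ^ 2) (N + 2 * s) := by
  have hq2 := hq.pow two_pos
  induction N with
  | zero =>
    rw [Finset.sum_eq_single_of_mem 0 (by simpa using hT)]
    · simp [qInv_zero]
    · intro t _ ht
      rw [qInv_of_neg _ (k := ((0 : ℕ) : ℤ) - t) (by omega), mul_zero]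
  | succ N ih =>
    have ih := ih (by omega)
    set G : ℕ → R := fun t => -((q ^ 2) ^ ((N + 1 - t : ℤ)).toNat * q ^ (t ^ 2 + 2 * s * t) *
      qPoch (-q) (q ^ 2) (s + t) *
      qInv (q ^ 2) (t - 1) * qInv (q ^ 2) (t + 2 * s - 1) * qInv (q ^ 2) (N + 1 - t)) with hG
    have key : (1 - (q ^ 2) ^ (N + 1)) * (1 - (q ^ 2) ^ (N + 1 + 2 * s)) *
        (∑ t ∈ Finset.range T, q ^ (t ^ 2 + 2 * s * t) * qPoch (-q) (q ^ 2) (s + t) *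
          qInv (q ^ 2) t * qInv (q ^ 2) (t + 2 * s) * qInv (q ^ 2) ((N + 1 : ℕ) - t)) -
        (1 + q ^ (2 * (s + N) + 1)) *
        ∑ t ∈ Finset.range T, q ^ (t ^ 2 + 2 * s * t) * qPoch (-q) (q ^ 2) (s + t) *
          qInv (q ^ 2) t * qInv (q ^ 2) (t + 2 * s) * qInv (q ^ 2) (N - t)
        = G T - G 0 := by
      rw [← Finset.sum_range_sub, Finset.mul_sum, Finset.mul_sum, ← Finset.sum_sub_distrib]
      refine Finset.sum_congr rfl fun t _ => ?_
      simp only [hG]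
      push_cast
      rcases lt_or_ge (N + 1) t with h | h
      · rw [qInv_of_neg _ (k := (N + 1 - t : ℤ)) (by omega),
          qInv_of_neg _ (k := (N - t : ℤ)) (by omega),
          qInv_of_neg _ (k := (N + 1 - (t + 1) : ℤ)) (by omega)]
        ring
      · obtain ⟨j, hj⟩ := Nat.exists_eq_add_of_le h
        rw [hj, show (N + 1 - (t + 1) : ℤ) = N + 1 - t - 1 by ring,
          show (N - t : ℤ) = N + 1 - t - 1 by ring,
          show (t + 1 + 2 * s - 1 : ℤ) = t + 2 * s by ring, add_sub_cancel_right,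
          hq2.qInv_pred j (k := (N + 1 - t : ℤ)) (by omega), hq2.qInv_pred t rfl,
          hq2.qInv_pred (t + 2 * s) (by push_cast; rfl), ← add_assoc, qPoch_succ]
        rcases j with _ | j
        · rw [show (N + 1 - t : ℤ).toNat = 0 by omega]
          ring
        · rw [show (N + 1 - t : ℤ).toNat = j + 1 by omega,
            show (N + 1 - t - 1 : ℤ).toNat = j by omega, show N = t + j by omega]
          ring
    rw [ih] at key
    have h0 : G T - G 0 = 0 := by
      simp only [hG]
      rw [qInv_of_neg _ (k := (N + 1 - T : ℤ)) (by omega),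
        qInv_of_neg _ (k := ((0 : ℕ) - 1 : ℤ)) (by omega)]
      ring
    rw [h0, sub_eq_zero] at key
    apply ((hq2 (N + 1) (by omega)).mul (hq2 (N + 1 + 2 * s) (by omega))).mul_left_cancel
    rw [key, show (N : ℤ) = (N + 1 : ℕ) - 1 by push_cast; ring,
      show (((N + 1 : ℕ) : ℤ) - 1 + 2 * s) = (N + 1 : ℕ) + 2 * s - 1 by ring,
      hq2.qInv_pred (N + 1) rfl, hq2.qInv_pred (N + 1 + 2 * s) (by push_cast; ring),
      ← add_assoc, qPoch_succ]
    push_cast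
    ring

end Algebra

theorem HasSum.congr_of_eq {R : Type*} [AddCommMonoid R] [TopologicalSpace R] {ι : Type*} {f g : ι → R} {x y : R} (h : HasSum f x)
    (hfg : ∀ i, g i = f i) (hxy : y = x) : HasSum g y := by
  rwa [funext hfg, hxy]

/-! ### The terminating sums recentred at an integer `s`, as used inside the Bailey lifts. -/

section Kernels

variable {R : Type*} [CommRing R]

theorem sum_range_eq_sum_range_add {M : Type*} [AddCommMonoid M] (f : ℕ → M) (s n : ℕ)
    (hf : ∀ r < s, f r = 0) :
    ∑ r ∈ Finset.range (s + n), f r = ∑ t ∈ Finset.range n, f (s + t) := by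
  rw [Finset.sum_range_add, Finset.sum_eq_zero fun r hr => hf r (Finset.mem_range.mp hr), zero_add]

/-- Both sides are invariant under `s ↦ -s - m`, which reduces to `s ≥ 0`; the shift `r = s + t`
then gives the terminating sum with parameter `2 * s + m`. The condition `hs` makes `s * (s + m)`
nonnegative, so `toNat` loses nothing. -/
theorem QUnits.sum_kernel {q : R} (hq : QUnits q) (m n : ℕ) {s : ℤ} (hs : 0 ≤ s ∨ s + m ≤ 0) :
    ∑ r ∈ Finset.range (n + 1),
        q ^ (r ^ 2 + m * r) * (qInv q (r - s) * qInv q (r + s + m)) * qInv q (n - r)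
      = q ^ (s * (s + m)).toNat * (qInv q (n - s) * qInv q (n + s + m)) := by
  wlog h : 0 ≤ s generalizing s
  · have := this (s := -s - m) (by omega) (by omega)
    refine Eq.trans (Finset.sum_congr rfl fun r _ => ?_) (this.trans ?_)
    · rw [mul_comm (qInv q (r - s)), show (r - s : ℤ) = r + (-s - m) + m by ring,
        show (r + s + m : ℤ) = r - (-s - m) by ring]
    · rw [mul_comm (qInv q (n - s)), show (n - s : ℤ) = n + (-s - m) + m by ring,
        show (n + s + m : ℤ) = n - (-s - m) by ring,
        show s * (s + m) = (-s - m) * (-s - m + m) by ring]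
  obtain ⟨s, rfl⟩ := Int.eq_ofNat_of_zero_le h
  rcases lt_or_ge n s with hn | hn
  · rw [qInv_of_neg q (k := (n - s : ℤ)) (by omega), zero_mul, mul_zero]
    refine Finset.sum_eq_zero fun r hr => ?_
    rw [Finset.mem_range] at hr
    rw [qInv_of_neg q (k := (r - s : ℤ)) (by omega)]
    ring
  · obtain ⟨N, rfl⟩ := Nat.exists_eq_add_of_le hn
    rw [add_assoc s N 1, sum_range_eq_sum_range_add]
    · have := hq.sum_qInv_mul_qInv_mul_qInv (2 * s + m) N (N + 1) N.lt_succ_self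
      rw [show (((s + N : ℕ) : ℤ) - s) = N by push_cast; ring,
        show (((s + N : ℕ) : ℤ) + s + m) = N + (2 * s + m : ℕ) by push_cast; ring, ← this,
        Finset.mul_sum, show ((s : ℤ) * (s + m)).toNat = s * (s + m) by norm_cast]
      refine Finset.sum_congr rfl fun t _ => ?_
      rw [show (((s + t : ℕ) : ℤ) - s) = t by push_cast; ring,
        show (((s + t : ℕ) : ℤ) + s + m) = t + (2 * s + m : ℕ) by push_cast; ring,
        show (((s + N : ℕ) : ℤ) - (s + t : ℕ)) = N - t by push_cast; ring]
      ring
    · intro r hr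
      rw [qInv_of_neg q (k := (r - s : ℤ)) (by omega)]
      ring

theorem QUnits.sum_kernel_sq {q : R} (hq : QUnits q) (m n : ℕ) {s : ℤ} (hs : 0 ≤ s ∨ s + m ≤ 0) :
    ∑ r ∈ Finset.range (n + 1), q ^ (2 * r ^ 2 + 2 * m * r) *
        (qInv (q ^ 2) (r - s) * qInv (q ^ 2) (r + s + m)) * qInv q (n - 2 * r)
      = q ^ (2 * (s * (s + m)).toNat) * qPoch q (q ^ 2) (n + m) *
        (qInv q (n - 2 * s) * qInv q (n + 2 * s + 2 * m)) := by
  wlog h : 0 ≤ s generalizing s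
  · have := this (s := -s - m) (by omega) (by omega)
    refine Eq.trans (Finset.sum_congr rfl fun r _ => ?_) (this.trans ?_)
    · rw [mul_comm (qInv (q ^ 2) (r - s)), show (r - s : ℤ) = r + (-s - m) + m by ring,
        show (r + s + m : ℤ) = r - (-s - m) by ring]
    · rw [mul_comm (qInv q (n - 2 * s)),
        show (n - 2 * s : ℤ) = n + 2 * (-s - m) + 2 * m by ring,
        show (n + 2 * s + 2 * m : ℤ) = n - 2 * (-s - m) by ring,
        show s * (s + m) = (-s - m) * (-s - m + m) by ring]
  obtain ⟨s, rfl⟩ := Int.eq_ofNat_of_zero_le h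
  rcases lt_or_ge n (2 * s) with hn | hn
  · rw [qInv_of_neg q (k := (n - 2 * s : ℤ)) (by omega), zero_mul, mul_zero]
    refine Finset.sum_eq_zero fun r hr => ?_
    rcases lt_or_ge r s with h | h
    · rw [qInv_of_neg (q ^ 2) (k := (r - s : ℤ)) (by omega)]
      ring
    · rw [qInv_of_neg q (k := (n - 2 * r : ℤ)) (by omega)]
      ring
  · obtain ⟨N, rfl⟩ := Nat.exists_eq_add_of_le hn
    -- After the shift, `t` runs up to `s + N`, beyond the support of the sum; this is why the
    -- terminating sums allow any bound `T > N`.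
    rw [show 2 * s + N + 1 = s + (s + N + 1) by ring, sum_range_eq_sum_range_add]
    · have := hq.sum_qInv_sq_mul_qInv_sq_mul_qInv (2 * s + m) N (s + N + 1) (by omega)
      rw [show (((2 * s + N : ℕ) : ℤ) - 2 * s) = N by push_cast; ring,
        show (((2 * s + N : ℕ) : ℤ) + 2 * s + 2 * m) = N + 2 * (2 * s + m : ℕ) by
          push_cast; ring, show 2 * s + N + m = N + (2 * s + m) by ring, mul_assoc,
        ← mul_assoc (qPoch _ _ _), ← this,
        Finset.mul_sum, show ((s : ℤ) * (s + m)).toNat = s * (s + m) by norm_cast]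
      refine Finset.sum_congr rfl fun t _ => ?_
      rw [show (((s + t : ℕ) : ℤ) - s) = t by push_cast; ring,
        show (((s + t : ℕ) : ℤ) + s + m) = t + (2 * s + m : ℕ) by push_cast; ring,
        show (((2 * s + N : ℕ) : ℤ) - 2 * (s + t : ℕ)) = N - 2 * t by push_cast; ring]
      ring
    · intro r hr
      rw [qInv_of_neg (q ^ 2) (k := (r - s : ℤ)) (by omega)]
      ring

theorem QUnits.sum_kernel_neg {q : R} (hq : QUnits q) (n : ℕ) (s : ℤ) :
    ∑ r ∈ Finset.range (n + 1), q ^ (r ^ 2) * qPoch (-q) (q ^ 2) r *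
        (qInv (q ^ 2) (r - s) * qInv (q ^ 2) (r + s)) * qInv (q ^ 2) (n - r)
      = q ^ (s ^ 2).toNat * qPoch (-q) (q ^ 2) n *
        (qInv (q ^ 2) (n - s) * qInv (q ^ 2) (n + s)) := by
  wlog h : 0 ≤ s generalizing s
  · have := this (s := -s) (by omega)
    refine Eq.trans (Finset.sum_congr rfl fun r _ => ?_) (this.trans ?_)
    · rw [mul_comm (qInv (q ^ 2) (r - s)), sub_neg_eq_add, ← sub_eq_add_neg]
    · rw [mul_comm (qInv (q ^ 2) (n - s)), sub_neg_eq_add, ← sub_eq_add_neg, neg_sq]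
  obtain ⟨s, rfl⟩ := Int.eq_ofNat_of_zero_le h
  rcases lt_or_ge n s with hn | hn
  · rw [qInv_of_neg _ (k := (n - s : ℤ)) (by omega), zero_mul, mul_zero]
    refine Finset.sum_eq_zero fun r hr => ?_
    rw [Finset.mem_range] at hr
    rw [qInv_of_neg _ (k := (r - s : ℤ)) (by omega)]
    ring
  · obtain ⟨N, rfl⟩ := Nat.exists_eq_add_of_le hn
    rw [add_assoc s N 1, sum_range_eq_sum_range_add]
    · have := hq.sum_qPoch_neg_mul_qInv s N (N + 1) N.lt_succ_self
      rw [show (((s + N : ℕ) : ℤ) - s) = N by push_cast; ring,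
        show (((s + N : ℕ) : ℤ) + s) = N + 2 * s by push_cast; ring, mul_assoc,
        ← mul_assoc (qPoch _ _ _), ← this,
        Finset.mul_sum, show ((s : ℤ) ^ 2).toNat = s ^ 2 by norm_cast]
      refine Finset.sum_congr rfl fun t _ => ?_
      rw [show (((s + t : ℕ) : ℤ) - s) = t by push_cast; ring,
        show (((s + t : ℕ) : ℤ) + s) = t + 2 * s by push_cast; ring,
        show (((s + N : ℕ) : ℤ) - (s + t : ℕ)) = N - t by push_cast; ring]
      ring
    · intro r hr
      rw [qInv_of_neg _ (k := (r - s : ℤ)) (by omega)]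
      ring

end Kernels

/-! ### Theta series and the finite Jacobi triple product. -/

section Theta

variable {R : Type*} [CommRing R]

/-- The exponent `k (k + 1) / 2` as a natural number. -/
def triangle (k : ℤ) : ℕ := (k * (k + 1) / 2).toNat

theorem triangle_mul_two (k : ℤ) : (triangle k : ℤ) * 2 = k * (k + 1) := by
  have h : 0 ≤ k * (k + 1) := by
    rcases lt_or_ge k 0 with h | h
    · nlinarith
    · positivity
  rw [triangle, Int.toNat_of_nonneg (Int.ediv_nonneg h (by norm_num)),
    Int.ediv_mul_cancel (Int.even_mul_succ_self k).two_dvd]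

/-- The general term `(-1)^k z^{k(k+1)/2} w^{k(k-1)/2}` of the Jacobi triple product. -/
def thetaTerm (z w : R) (k : ℤ) : R :=
  (-1) ^ k.natAbs * z ^ triangle k * w ^ triangle (-k)

theorem thetaTerm_neg (z w : R) (k : ℤ) : thetaTerm z w (-k) = thetaTerm w z k := by
  simp only [thetaTerm, Int.natAbs_neg, neg_neg]
  ring

theorem thetaTerm_pow (q : R) (i j : ℕ) (k : ℤ) :
    thetaTerm (q ^ i) (q ^ j) k = q ^ (i * triangle k + j * triangle (-k)) * (-1) ^ k.natAbs := by
  rw [thetaTerm, pow_add, pow_mul, pow_mul]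
  ring

/-- The ratio of consecutive terms is `-z (zw)^k`; the factor `(z * w) ^ j` clears the negative
powers that arise for `k < 0`. -/
theorem pow_mul_thetaTerm_succ (z w : R) {k : ℤ} {j a : ℕ} (h : j + k = a) :
    (z * w) ^ j * thetaTerm z w (k + 1) = -(z * (z * w) ^ a) * thetaTerm z w k := by
  have h1 : triangle (k + 1) + j = triangle k + (a + 1) := by
    zify
    linarith [triangle_mul_two k, triangle_mul_two (k + 1)]
  have h2 : triangle (-(k + 1)) + j = triangle (-k) + a := by
    zify
    linarith [triangle_mul_two (-k), triangle_mul_two (-(k + 1))]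
  have h3 : (-1 : R) ^ (k + 1).natAbs = -(-1) ^ k.natAbs := by
    rcases lt_or_ge k 0 with hk | hk
    · rw [show k.natAbs = (k + 1).natAbs + 1 by omega, pow_succ]
      ring
    · rw [show (k + 1).natAbs = k.natAbs + 1 by omega, pow_succ]
      ring
  calc (z * w) ^ j * thetaTerm z w (k + 1)
      = (-1) ^ (k + 1).natAbs * z ^ (triangle (k + 1) + j) * w ^ (triangle (-(k + 1)) + j) := by
        rw [thetaTerm]; ring
    _ = _ := by rw [h1, h2, h3, thetaTerm]; ring

variable [TopologicalSpace R] [IsTopologicalRing R]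

theorem HasSum.of_isUnit_mul {ι : Type*} {f : ι → R} {c x y : R} (hc : IsUnit c)
    (hf : HasSum (fun i => c * f i) x) (hx : x = c * y) : HasSum f y := by
  obtain ⟨c, rfl⟩ := hc
  simpa [hx] using hf.mul_left (↑c⁻¹ : R)

theorem QUnits.hasSum_thetaTerm_succ {z w : R} (hq : QUnits (z * w)) {a b : ℕ} {S : R}
    (h : HasSum (fun k : ℤ => thetaTerm z w k * qInv (z * w) (a - k) * qInv (z * w) (b + k))
      (S * qInv (z * w) (a + b))) :
    HasSum (fun k : ℤ => thetaTerm z w k * qInv (z * w) ((a + 1 : ℕ) - k) * qInv (z * w) (b + k))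
      (S * (1 - z * (z * w) ^ a) * qInv (z * w) ((a + 1 : ℕ) + b)) := by
  -- With `Q = zw`, `i = b + k` and `j = a + 1 - k`, the step rests on `1 - Q^{i+j} = (1 - Q^j) +
  -- Q^j (1 - Q^i)`. The first part returns the series for `(a, b)`; the second, treated here, is a
  -- shift of it by `k ↦ k + 1`.
  have h2 : HasSum (fun k : ℤ => (z * w) ^ (a + 1 - k).toNat * thetaTerm z w k *
      qInv (z * w) (a + 1 - k) * qInv (z * w) (b + k - 1))
      (-(z * (z * w) ^ a) * (S * qInv (z * w) (a + b))) := by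
    rw [← (Equiv.addRight (1 : ℤ)).hasSum_iff]
    refine (h.mul_left (-(z * (z * w) ^ a))).congr_of_eq (fun k => ?_) rfl
    simp only [Function.comp_apply, Equiv.coe_addRight]
    rw [show (a + 1 - (k + 1) : ℤ) = a - k by ring, show (b + (k + 1) - 1 : ℤ) = b + k by ring]
    rcases lt_or_ge (a : ℤ) k with hk | hk
    · rw [qInv_of_neg _ (k := a - k) (by omega)]
      ring
    · rw [pow_mul_thetaTerm_succ z w (a := a) (by omega)]
      ring
  refine HasSum.of_isUnit_mul (hq (a + b + 1) (by omega))
    (x := (1 - z * (z * w) ^ a) * (S * qInv (z * w) (a + b))) ?_ ?_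
  · refine (h.add h2).congr_of_eq (fun k => ?_) ?_
    · rcases lt_or_ge (a + 1 : ℤ) k with hk | hk
      · rw [qInv_of_neg _ (k := a - k) (by omega), qInv_of_neg _ (k := a + 1 - k) (by omega),
          qInv_of_neg _ (k := (a + 1 : ℕ) - k) (by omega)]
        ring
      · rcases lt_or_ge (b + k : ℤ) 0 with hk' | hk'
        · rw [qInv_of_neg _ hk', qInv_of_neg _ (k := b + k - 1) (by omega)]
          ring
        · obtain ⟨i, hi⟩ := Int.eq_ofNat_of_zero_le hk'
          obtain ⟨j, hj⟩ := Int.eq_ofNat_of_zero_le (a := a + 1 - k) (by omega)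
          rw [show (a - k : ℤ) = a + 1 - k - 1 by ring, hq.qInv_pred j hj, hq.qInv_pred i hi,
            hj, hi, show ((a + 1 : ℕ) : ℤ) - k = j by push_cast; omega,
            show a + b + 1 = i + j by omega, Int.toNat_natCast]
          ring
    · ring
  · rw [show (a + b : ℤ) = (a + 1 : ℕ) + b - 1 by push_cast; ring,
      hq.qInv_pred (a + b + 1) (by push_cast; ring)]
    ring

/-- The finite form of the Jacobi triple product identity. -/
theorem QUnits.hasSum_thetaTerm {z w : R} (hq : QUnits (z * w)) (a b : ℕ) :
    HasSum (fun k : ℤ => thetaTerm z w k * qInv (z * w) (a - k) * qInv (z * w) (b + k))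
      (qPoch z (z * w) a * qPoch w (z * w) b * qInv (z * w) (a + b)) := by
  have swap : ∀ (z w : R) (a b : ℕ),
      HasSum (fun k : ℤ => thetaTerm z w k * qInv (z * w) (a - k) * qInv (z * w) (b + k))
        (qPoch z (z * w) a * qPoch w (z * w) b * qInv (z * w) (a + b)) →
      HasSum (fun k : ℤ => thetaTerm w z k * qInv (w * z) (b - k) * qInv (w * z) (a + k))
        (qPoch w (w * z) b * qPoch z (w * z) a * qInv (w * z) (b + a)) := by
    intro z w a b h
    rw [← (Equiv.neg ℤ).hasSum_iff] at h
    refine h.congr_of_eq (fun k => ?_) ?_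
    · simp only [Function.comp_apply, Equiv.neg_apply, thetaTerm_neg, sub_neg_eq_add, mul_comm w z,
        ← sub_eq_add_neg]
      ring
    · rw [mul_comm w z, add_comm (b : ℤ)]
      ring
  have left : ∀ (z w : R) (_ : QUnits (z * w)) (b : ℕ),
      HasSum (fun k : ℤ => thetaTerm z w k * qInv (z * w) ((0 : ℕ) - k) * qInv (z * w) (b + k))
        (qPoch z (z * w) 0 * qPoch w (z * w) b * qInv (z * w) ((0 : ℕ) + b)) →
      ∀ a : ℕ, HasSum (fun k : ℤ => thetaTerm z w k * qInv (z * w) (a - k) * qInv (z * w) (b + k))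
        (qPoch z (z * w) a * qPoch w (z * w) b * qInv (z * w) (a + b)) := by
    intro z w hq b h a
    induction a with
    | zero => exact h
    | succ a ih =>
      convert hq.hasSum_thetaTerm_succ ih using 1
      rw [qPoch_succ]
      ring
  -- From `a = b = 0`, `b` is raised with the roles of `z` and `w` exchanged; after swapping back,
  -- `a` is raised.
  refine left z w hq b (swap w z b 0 (left w z (by rwa [mul_comm]) 0 ?_ b)) a
  refine (hasSum_single (0 : ℤ) ?_).congr_of_eq (fun _ => rfl) ?_
  rotate_left
  · simp [qPoch_zero, qInv_zero, thetaTerm, triangle]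
  · intro k hk
    rcases lt_or_gt_of_ne hk with hk | hk
    · rw [qInv_of_neg _ (k := (0 : ℕ) + k) (by omega), mul_zero]
    · rw [qInv_of_neg _ (k := (0 : ℕ) - k) (by omega)]
      ring

/-- The unit Bailey pair: `(1;q)_n` contains the factor `1 - 1` unless `n = 0`. -/
theorem QUnits.hasSum_thetaTerm_one {q : R} (hq : QUnits q) (n m : ℕ) :
    HasSum (fun k : ℤ => thetaTerm 1 q k * (qInv q (n - k) * qInv q (n + k + m)))
      (if n = 0 then 1 else 0) := by
  have h := QUnits.hasSum_thetaTerm (z := 1) (w := q) (by rwa [one_mul]) n (n + m)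
  rw [one_mul] at h
  refine h.congr_of_eq (fun k => ?_) ?_
  · rw [mul_assoc, show (n + k + m : ℤ) = (n + m : ℕ) + k by push_cast; ring]
  · split_ifs with hn
    · subst hn
      simpa [qPoch_zero] using (hq.qPoch_mul_qInv m).symm
    · obtain ⟨n, rfl⟩ := Nat.exists_eq_succ_of_ne_zero hn
      have : qPoch 1 q (n + 1) = 0 := by
        rw [qPoch, Finset.prod_range_succ']
        simp
      rw [Nat.succ_eq_add_one, this]
      ring

end Theta

/-! ### Bailey lifts: new pairs from old. -/

section Lifts

variable {R : Type*} [CommRing R] [TopologicalSpace R] [IsTopologicalRing R]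

/-- The Bailey lemma with both parameters sent to infinity: exchange the sums over `r` and `k`, then
evaluate the inner one by `QUnits.sum_kernel`. -/
theorem QUnits.hasSum_lift {q : R} (hq : QUnits q) {ι : Type*} {m : ℕ} {s : ι → ℤ}
    (hs : ∀ k, 0 ≤ s k ∨ s k + m ≤ 0) {a : ι → R} {β : ℕ → R}
    (h : ∀ n : ℕ, HasSum (fun k => a k * (qInv q (n - s k) * qInv q (n + s k + m))) (β n)) (n : ℕ) :
    HasSum (fun k => a k * q ^ (s k * (s k + m)).toNat *
        (qInv q (n - s k) * qInv q (n + s k + m)))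
      (∑ r ∈ Finset.range (n + 1), q ^ (r ^ 2 + m * r) * β r * qInv q (n - r)) := by
  refine (hasSum_sum fun r (_ : r ∈ Finset.range (n + 1)) =>
    ((h r).mul_left (q ^ (r ^ 2 + m * r))).mul_right (qInv q (n - r))).congr_of_eq (fun k => ?_) rfl
  rw [mul_assoc, ← hq.sum_kernel m n (hs k), Finset.mul_sum]
  exact Finset.sum_congr rfl fun r _ => by ring

/-- The change of base from `q²` to `q`. As `m` doubles, `(q²)^m = q^{2m}`, so the pair remains
relative to the same `a`. -/
theorem QUnits.hasSum_lift_sq {q : R} (hq : QUnits q) {ι : Type*} {m : ℕ} {s : ι → ℤ}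
    (hs : ∀ k, 0 ≤ s k ∨ s k + m ≤ 0) {a : ι → R} {β : ℕ → R}
    (h : ∀ n : ℕ, HasSum (fun k => a k * (qInv (q ^ 2) (n - s k) * qInv (q ^ 2) (n + s k + m)))
      (β n)) (n : ℕ) :
    HasSum (fun k => a k * q ^ (2 * (s k * (s k + m)).toNat) *
        (qInv q (n - 2 * s k) * qInv q (n + 2 * s k + (2 * m : ℕ))))
      (Ring.inverse (qPoch q (q ^ 2) (n + m)) *
        ∑ r ∈ Finset.range (n + 1), q ^ (2 * r ^ 2 + 2 * m * r) * β r * qInv q (n - 2 * r)) := by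
  refine HasSum.of_isUnit_mul (hq.isUnit_qPoch_sq (n + m)) ?_
    (Ring.mul_inverse_cancel_left _ _ (hq.isUnit_qPoch_sq (n + m))).symm
  refine (hasSum_sum fun r (_ : r ∈ Finset.range (n + 1)) =>
    ((h r).mul_left (q ^ (2 * r ^ 2 + 2 * m * r))).mul_right (qInv q (n - 2 * r))).congr_of_eq (fun k => ?_) rfl
  have := hq.sum_kernel_sq m n (hs k)
  calc _ = a k * (q ^ (2 * (s k * (s k + m)).toNat) * qPoch q (q ^ 2) (n + m) *
        (qInv q (n - 2 * s k) * qInv q (n + 2 * s k + 2 * m))) := by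
          push_cast; ring
    _ = _ := by
      rw [← this, Finset.mul_sum]
      exact Finset.sum_congr rfl fun r _ => by ring

/-- The Bailey lemma in base `q²` relative to `a = 1`, with one parameter equal to `-q` and the
other sent to infinity. -/
theorem QUnits.hasSum_lift_neg {q : R} (hq : QUnits q) {ι : Type*} {s : ι → ℤ}
    {a : ι → R} {β : ℕ → R}
    (h : ∀ n : ℕ, HasSum (fun k => a k * (qInv (q ^ 2) (n - s k) * qInv (q ^ 2) (n + s k)))
      (β n)) (n : ℕ) :
    HasSum (fun k => a k * q ^ (s k ^ 2).toNat *
        (qPoch (-q) (q ^ 2) n * (qInv (q ^ 2) (n - s k) * qInv (q ^ 2) (n + s k))))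
      (∑ r ∈ Finset.range (n + 1), q ^ (r ^ 2) * qPoch (-q) (q ^ 2) r * β r *
        qInv (q ^ 2) (n - r)) := by
  refine (hasSum_sum fun r (_ : r ∈ Finset.range (n + 1)) =>
    ((h r).mul_left (q ^ (r ^ 2) * qPoch (-q) (q ^ 2) r)).mul_right (qInv (q ^ 2) (n - r))).congr_of_eq (fun k => ?_) rfl
  have := hq.sum_kernel_neg n (s k)
  calc _ = a k * (q ^ (s k ^ 2).toNat * qPoch (-q) (q ^ 2) n *
        (qInv (q ^ 2) (n - s k) * qInv (q ^ 2) (n + s k))) := by ring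
    _ = _ := by
      rw [← this, Finset.mul_sum]
      exact Finset.sum_congr rfl fun r _ => by ring

end Lifts

/-! ### Limits of q-series in an abstract topological ring. -/

section Limits

open Filter Topology

theorem summable_pow_theta {i j : ℕ} (hi : 0 < i) (hj : 0 < j) (r : ℝ) (h0 : 0 ≤ r) (h1 : r < 1) :
    Summable fun k : ℤ => r ^ (i * triangle k + j * triangle (-k)) := by
  have hs : Summable fun k : ℤ => r ^ k.natAbs := by
    apply Summable.of_nat_of_neg <;> simpa using summable_geometric_of_lt_one h0 h1
  refine hs.of_nonneg_of_le (fun k => by positivity) fun k => pow_le_pow_of_le_one h0 h1.le ?_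
  have h2 : k.natAbs ≤ triangle k + triangle (-k) := by
    zify
    have h3 : |k| ≤ |k| * |k| := by
      rcases eq_or_ne k 0 with rfl | hk
      · simp
      · exact le_mul_of_one_le_left (abs_nonneg k) (Int.one_le_abs hk)
    rw [abs_mul_abs_self] at h3
    linarith [triangle_mul_two k, triangle_mul_two (-k)]
  nlinarith [Nat.zero_le (triangle k), Nat.zero_le (triangle (-k))]

theorem hasSum_of_triangular {R : Type*} [AddCommMonoid R] [TopologicalSpace R] {f : ℕ × ℕ → R} {N : ℕ} (h1 : ∀ n r, N < n → f (n, r) = 0)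
    (h2 : ∀ n r, n < r → f (n, r) = 0) :
    HasSum f (∑ n ∈ Finset.range (N + 1), ∑ r ∈ Finset.range (n + 1), f (n, r)) := by
  have h : HasSum f (∑ p ∈ Finset.range (N + 1) ×ˢ Finset.range (N + 1), f p) := by
    refine hasSum_sum_of_ne_finset_zero fun p hp => ?_
    rw [Finset.mem_product, Finset.mem_range, Finset.mem_range] at hp
    rcases lt_or_ge N p.1 with h | h
    · exact h1 _ _ h
    · exact h2 _ _ (by omega)
  rw [Finset.sum_product] at h
  refine h.congr_of_eq (fun _ => rfl) (Finset.sum_congr rfl fun n hn => ?_)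
  refine Finset.sum_subset (fun r hr => ?_) fun r _ hr => h2 _ _ (by simpa using hr)
  rw [Finset.mem_range] at *
  omega

/-- A topological ring with enough structure for limits of `q`-series: a notion of admissible base
`q`, and a size function giving a notion of boundedness for which a dominated convergence theorem
holds for families dominated by powers of `q`. -/
class QSeriesRing (R : Type*) [CommRing R] [TopologicalSpace R] where
  small : R → Prop
  size : R → ℝ
  size_nonneg (a : R) : 0 ≤ size a
  size_mul_le (a b : R) : size (a * b) ≤ size a * size b
  exists_size_le_of_tendsto {f : ℕ → R} {a : R} (hf : Tendsto f atTop (𝓝 a)) :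
    ∃ C, ∀ n, size (f n) ≤ C
  small_pow {q : R} (hq : small q) {k : ℕ} (hk : 0 < k) : small (q ^ k)
  isUnit_one_sub {q : R} (hq : small q) : IsUnit (1 - q)
  multipliable {q : R} (hq : small q) (a : R) : Multipliable fun j : ℕ => 1 - a * q ^ j
  tendsto_inverse {q : R} (hq : small q) :
    ∃ L, Tendsto (fun n => Ring.inverse (qPoch q q n)) atTop (𝓝 L)
  tannery {ι : Type} {q : R} (hq : small q) {e : ι → ℕ}
    (he : ∀ r : ℝ, 0 ≤ r → r < 1 → Summable fun i => r ^ e i) {b : ℕ → ι → R} {c : ι → R}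
    (hb : ∃ C, ∀ n i, size (b n i) ≤ C) (hc : ∀ i, Tendsto (b · i) atTop (𝓝 (c i)))
    {x : ℕ → R} (hx : ∀ n, HasSum (fun i => q ^ e i * b n i) (x n)) :
    ∃ y, Tendsto x atTop (𝓝 y) ∧ HasSum (fun i => q ^ e i * c i) y

namespace QSeriesRing

variable {R : Type*} [CommRing R] [TopologicalSpace R] [QSeriesRing R]

/-- Boundedness of a family with respect to `QSeriesRing.size`. -/
def Bdd {ι : Type*} (f : ι → R) : Prop := ∃ C, ∀ i, size (f i) ≤ C

theorem Bdd.mul {ι : Type*} {f g : ι → R} (hf : Bdd f) (hg : Bdd g) : Bdd fun i => f i * g i := by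
  obtain ⟨C, hC⟩ := hf
  obtain ⟨D, hD⟩ := hg
  exact ⟨C * D, fun i => (size_mul_le _ _).trans (mul_le_mul (hC i) (hD i) (size_nonneg _)
    ((size_nonneg _).trans (hC i)))⟩

theorem Bdd.comp {ι κ : Type*} {f : ι → R} (hf : Bdd f) (g : κ → ι) : Bdd fun i => f (g i) := by
  obtain ⟨C, hC⟩ := hf
  exact ⟨C, fun i => hC (g i)⟩

theorem bdd_neg_one_pow : Bdd fun n : ℕ => (-1 : R) ^ n := by
  refine ⟨max (size (1 : R)) (size (-1 : R)), fun n => ?_⟩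
  rcases neg_one_pow_eq_or R n with h | h <;> simp [h]

theorem small.qUnits {q : R} (hq : small q) : QUnits q := fun _ hk =>
  isUnit_one_sub (small_pow hq hk)

theorem tendsto_qPoch {q : R} (hq : small q) (a : R) :
    Tendsto (qPoch a q) atTop (𝓝 (qPochInf a q)) :=
  (multipliable hq a).hasProd.tendsto_prod_nat

theorem bdd_qPoch {q : R} (hq : small q) (a : R) : Bdd (qPoch a q) :=
  exists_size_le_of_tendsto (tendsto_qPoch hq a)

theorem bdd_qInv {q : R} (hq : small q) : Bdd (qInv q) := by
  obtain ⟨L, hL⟩ := tendsto_inverse hq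
  obtain ⟨C, hC⟩ := exists_size_le_of_tendsto hL
  refine ⟨max C (size (0 : R)), fun k => ?_⟩
  unfold qInv
  split_ifs
  · exact le_max_of_le_left (hC _)
  · exact le_max_right _ _

theorem bdd_inverse_qPoch_sq {q : R} (hq : small q) :
    Bdd fun n => Ring.inverse (qPoch q (q ^ 2) n) := by
  have h := ((bdd_qInv hq).comp fun n : ℕ => ((2 * n : ℕ) : ℤ)).mul
    (bdd_qPoch (small_pow hq two_pos) (q ^ 2))
  simpa only [hq.qUnits.inverse_qPoch_sq] using h

variable [IsTopologicalRing R]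

/-- Weighted theta series converge to the theta series when the weights do so boundedly. -/
theorem tendsto_of_hasSum_thetaTerm {q : R} (hq : small q) {i j : ℕ} (hi : 0 < i) (hj : 0 < j)
    {b : ℕ → ℤ → R} {L : R} (hb : Bdd fun p : ℕ × ℤ => b p.1 p.2)
    (hL : ∀ k, Tendsto (b · k) atTop (𝓝 L)) {x : ℕ → R}
    (hx : ∀ n, HasSum (fun k => thetaTerm (q ^ i) (q ^ j) k * b n k) (x n)) :
    ∃ y, Tendsto x atTop (𝓝 y) ∧ HasSum (fun k => thetaTerm (q ^ i) (q ^ j) k * L) y := by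
  simp only [thetaTerm_pow, mul_assoc] at hx ⊢
  refine tannery hq (summable_pow_theta hi hj) ?_ (fun k => (hL k).const_mul _) hx
  obtain ⟨C, hC⟩ := (bdd_neg_one_pow.comp fun p : ℕ × ℤ => p.2.natAbs).mul hb
  exact ⟨C, fun n k => hC (n, k)⟩

variable [T2Space R]

theorem tendsto_inverse_qPoch {q : R} (hq : small q) : qPochInf q q * Ring.inverse (qPochInf q q) = 1
    ∧ Tendsto (fun n => Ring.inverse (qPoch q q n)) atTop (𝓝 (Ring.inverse (qPochInf q q))) := by
  obtain ⟨L, hL⟩ := tendsto_inverse hq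
  have h : qPochInf q q * L = 1 := by
    refine tendsto_nhds_unique ((tendsto_qPoch hq q).mul hL) ?_
    simp [fun n => Ring.mul_inverse_cancel _ (hq.qUnits.isUnit_qPoch n)]
  have h' : Ring.inverse (qPochInf q q) = L := by
    have hu : IsUnit (qPochInf q q) := IsUnit.of_mul_eq_one _ h
    apply hu.mul_left_cancel
    rw [h, Ring.mul_inverse_cancel _ hu]
  rw [h']
  exact ⟨h, hL⟩

theorem tendsto_qInv {q : R} (hq : small q) (j : ℤ) :
    Tendsto (fun n : ℕ => qInv q (n + j)) atTop (𝓝 (Ring.inverse (qPochInf q q))) := by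
  have h : Tendsto (fun n : ℕ => (n + j).toNat) atTop atTop :=
    tendsto_atTop_atTop.mpr fun b => ⟨b + j.natAbs, fun n hn => by omega⟩
  refine ((tendsto_inverse_qPoch hq).2.comp h).congr' ?_
  filter_upwards [eventually_ge_atTop j.natAbs] with n hn
  rw [Function.comp_apply, ← qInv_natCast, Int.toNat_of_nonneg (by omega)]

/-- The Jacobi triple product identity. -/
theorem hasSum_thetaTerm {q : R} (hq : small q) {i j : ℕ} (hi : 0 < i) (hj : 0 < j) :
    HasSum (thetaTerm (q ^ i) (q ^ j))
      (qPochInf (q ^ i) (q ^ (i + j)) * qPochInf (q ^ j) (q ^ (i + j)) *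
        qPochInf (q ^ (i + j)) (q ^ (i + j))) := by
  have hQ := small_pow hq (k := i + j) (by omega)
  have hfin := fun n : ℕ => QUnits.hasSum_thetaTerm (z := q ^ i) (w := q ^ j)
    (by rw [← pow_add]; exact hQ.qUnits) n n
  simp only [← pow_add, mul_assoc] at hfin
  obtain ⟨hP, -⟩ := tendsto_inverse_qPoch hQ
  set Q := q ^ (i + j)
  have hu := bdd_qInv hQ
  -- In the finite form with `a = b = n`, both weights tend to `1/(Q;Q)_∞`, while the product side
  -- retains only one such factor.
  obtain ⟨y, hy, hs⟩ := tendsto_of_hasSum_thetaTerm hq hi hj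
    (b := fun n k => qInv Q (n - k) * qInv Q (n + k))
    ((hu.comp fun p : ℕ × ℤ => p.1 - p.2).mul (hu.comp fun p : ℕ × ℤ => p.1 + p.2))
    (fun k => by simpa only [sub_eq_add_neg] using (tendsto_qInv hQ (-k)).mul (tendsto_qInv hQ k))
    hfin
  have h2 : Tendsto (fun n : ℕ => qInv Q (n + n)) atTop (𝓝 (Ring.inverse (qPochInf Q Q))) := by
    refine ((tendsto_qInv hQ 0).comp (tendsto_atTop_mono (fun n => Nat.le_add_left n n) tendsto_id)).congr fun n => ?_
    simp
  have hy' := tendsto_nhds_unique hy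
    ((tendsto_qPoch hQ (q ^ i)).mul ((tendsto_qPoch hQ (q ^ j)).mul h2))
  refine (hs.mul_right (qPochInf Q Q * qPochInf Q Q)).congr_of_eq (fun k => ?_) ?_
  · linear_combination (-thetaTerm (q ^ i) (q ^ j) k *
      (qPochInf Q Q * Ring.inverse (qPochInf Q Q) + 1)) * hP
  · rw [hy']
    linear_combination (-qPochInf (q ^ i) Q * qPochInf (q ^ j) Q * qPochInf Q Q) * hP

/-- If the truncations by `1/(p;p)_{N-n}` of a double series are given by weighted theta series,
then the double series is the product of the theta function and the limiting weight. -/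
theorem hasSum_double {q p : R} (hq : small q) (hp : small p) {i j : ℕ} (hi : 0 < i) (hj : 0 < j)
    {e : ℕ × ℕ → ℕ} (he : ∀ n : ℕ × ℕ, n.1 + n.2 ≤ e n) {c : ℕ × ℕ → R} (hc : Bdd c)
    (hc0 : ∀ n r, n < r → c (n, r) = 0)
    {b : ℕ → ℤ → R} {L : R} (hb : Bdd fun p : ℕ × ℤ => b p.1 p.2)
    (hL : ∀ k, Tendsto (b · k) atTop (𝓝 L))
    (hx : ∀ N : ℕ, HasSum (fun k => thetaTerm (q ^ i) (q ^ j) k * b N k)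
      (∑ n ∈ Finset.range (N + 1), ∑ r ∈ Finset.range (n + 1),
        q ^ e (n, r) * (c (n, r) * qInv p (N - n)))) :
    HasSum (fun n => q ^ e n * c n)
      (qPochInf (q ^ i) (q ^ (i + j)) * qPochInf (q ^ j) (q ^ (i + j)) *
        qPochInf (q ^ (i + j)) (q ^ (i + j)) * L * qPochInf p p) := by
  obtain ⟨hP, -⟩ := tendsto_inverse_qPoch hp
  obtain ⟨y, hy, hs⟩ := tendsto_of_hasSum_thetaTerm hq hi hj hb hL hx
  have hyL := hs.unique ((hasSum_thetaTerm hq hi hj).mul_right L)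
  have hgrowth : ∀ r : ℝ, 0 ≤ r → r < 1 → Summable fun n => r ^ e n := by
    intro r h0 h1
    have hg := summable_geometric_of_lt_one h0 h1
    refine (hg.mul_of_nonneg hg (fun _ => by positivity) (fun _ => by positivity)).of_nonneg_of_le
      (fun n => by positivity) fun n => ?_
    rw [← pow_add]
    exact pow_le_pow_of_le_one h0 h1.le (he n)
  obtain ⟨y', hy', hs'⟩ := tannery hq hgrowth
    (b := fun (N : ℕ) n => c n * qInv p (N - n.1))
    (by
      obtain ⟨C, hC⟩ := (hc.comp fun m : ℕ × ℕ × ℕ => m.2).mul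
        ((bdd_qInv hp).comp fun m : ℕ × ℕ × ℕ => m.1 - m.2.1)
      exact ⟨C, fun N n => hC (N, n)⟩)
    (fun n => by simpa only [sub_eq_add_neg] using (tendsto_qInv hp (-n.1)).const_mul (c n))
    (fun N => hasSum_of_triangular (N := N)
      (fun n r h => by rw [qInv_of_neg p (k := N - (n, r).1) (by dsimp only; omega)]; ring)
      (fun n r h => by rw [hc0 n r h]; ring))
  refine (hs'.mul_right (qPochInf p p)).congr_of_eq (fun n => ?_) ?_
  · linear_combination (-q ^ e n * c n) * hP
  · rw [← tendsto_nhds_unique hy hy', hyL]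

end QSeriesRing

end Limits

/-! ### The identities of moduli 60 and 88. -/

section Identities

open Filter Topology

variable {R : Type*} [CommRing R]

/-- The exponents add up to `2k(k-1) + (4 + 8 + 16) k(k+ε) = 30k² + (28ε - 2)k`: the unit pair in
base `q⁴`, then two changes of base and one Bailey step. Hence `i + j = 60` and `i - j = 56ε - 4`.
-/
theorem thetaTerm_one_mul_pow (q : R) {ε i j : ℕ} (hi : i = 28 + 28 * ε)
    (hj : j + 28 * ε = 32) (k : ℤ) :
    thetaTerm 1 ((q ^ 2) ^ 2) k * (q ^ 2) ^ (2 * (k * (k + ε)).toNat) *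
        q ^ (2 * (2 * k * (2 * k + (2 * ε : ℕ))).toNat) *
        q ^ (2 * (2 * k) * (2 * (2 * k) + (2 * (2 * ε) : ℕ))).toNat
      = thetaTerm (q ^ i) (q ^ j) k := by
  have h0 : 0 ≤ k * (k + ε) := by
    rcases lt_or_ge k 0 with h | h
    · exact mul_nonneg_of_nonpos_of_nonpos h.le (by omega)
    · positivity
  have h1 : 4 * triangle (-k) + 4 * (k * (k + ε)).toNat +
      2 * (2 * k * (2 * k + (2 * ε : ℕ))).toNat +
      (2 * (2 * k) * (2 * (2 * k) + (2 * (2 * ε) : ℕ))).toNat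
      = i * triangle k + j * triangle (-k) := by
    zify at hi hj ⊢
    rw [Int.toNat_of_nonneg h0, Int.toNat_of_nonneg (by linarith),
      Int.toNat_of_nonneg (by linarith), hi, eq_sub_of_add_eq hj]
    linear_combination (-14 - 14 * (ε : ℤ)) * triangle_mul_two k +
      (-14 + 14 * (ε : ℤ)) * triangle_mul_two (-k)
  rw [thetaTerm_pow, ← h1, thetaTerm]
  ring

section Pairs

variable [TopologicalSpace R] [IsTopologicalRing R] {q : R}

theorem QUnits.hasSum_lift_one (hq : QUnits q) {ε : ℕ} (hε : ε ≤ 1) (n : ℕ) :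
    HasSum (fun k : ℤ => thetaTerm 1 (q ^ 2) k * q ^ (2 * (k * (k + ε)).toNat) *
        (qInv q (n - 2 * k) * qInv q (n + 2 * k + (2 * ε : ℕ))))
      (Ring.inverse (qPoch q (q ^ 2) (n + ε)) * qInv q n) := by
  refine (hq.hasSum_lift_sq (s := id) (m := ε) (fun k => by dsimp only [id]; omega)
    (fun n => (hq.pow two_pos).hasSum_thetaTerm_one n ε) n).congr_of_eq (fun k => rfl) ?_
  -- The unit pair has `β r = 0` for `r ≠ 0`, so only `r = 0` contributes.
  rw [Finset.sum_eq_single_of_mem 0 (by simp) fun r _ hr => by simp [hr]]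
  simp

theorem QUnits.hasSum_lift_lift_one (hq : QUnits q) {ε : ℕ} (hε : ε ≤ 1) (n : ℕ) :
    HasSum (fun k : ℤ => thetaTerm 1 ((q ^ 2) ^ 2) k * (q ^ 2) ^ (2 * (k * (k + ε)).toNat) *
        q ^ (2 * (2 * k * (2 * k + (2 * ε : ℕ))).toNat) *
        (qInv q (n - 2 * (2 * k)) * qInv q (n + 2 * (2 * k) + (2 * (2 * ε) : ℕ))))
      (Ring.inverse (qPoch q (q ^ 2) (n + 2 * ε)) *
        ∑ r ∈ Finset.range (n + 1), q ^ (2 * r ^ 2 + 2 * (2 * ε) * r) *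
          (Ring.inverse (qPoch (q ^ 2) ((q ^ 2) ^ 2) (r + ε)) * qInv (q ^ 2) r) *
          qInv q (n - 2 * r)) :=
  hq.hasSum_lift_sq (s := fun k => 2 * k) (fun k => by push_cast; omega)
    ((hq.pow two_pos).hasSum_lift_one hε) n

end Pairs

namespace QSeriesRing

variable [TopologicalSpace R] [QSeriesRing R] {q : R}

theorem bdd_coeff (hq : small q) (i j : ℕ) : Bdd fun p : ℕ × ℕ =>
    Ring.inverse (qPoch q (q ^ 2) (p.1 + i)) *
      (Ring.inverse (qPoch (q ^ 2) ((q ^ 2) ^ 2) (p.2 + j)) * qInv (q ^ 2) p.2) *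
      qInv q (p.1 - 2 * p.2) := by
  have hq2 := small_pow hq two_pos
  exact (((bdd_inverse_qPoch_sq hq).comp fun p : ℕ × ℕ => p.1 + i).mul
    (((bdd_inverse_qPoch_sq hq2).comp fun p : ℕ × ℕ => p.2 + j).mul
      ((bdd_qInv hq2).comp fun p : ℕ × ℕ => (p.2 : ℤ)))).mul
    ((bdd_qInv hq).comp fun p : ℕ × ℕ => (p.1 - 2 * p.2 : ℤ))

theorem bdd_qInv_mul_qInv (hq : small q) (m : ℕ) :
    Bdd fun p : ℕ × ℤ => qInv q (p.1 - 2 * (2 * p.2)) * qInv q (p.1 + 2 * (2 * p.2) + m) :=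
  ((bdd_qInv hq).comp fun p : ℕ × ℤ => (p.1 - 2 * (2 * p.2) : ℤ)).mul
    ((bdd_qInv hq).comp fun p : ℕ × ℤ => (p.1 + 2 * (2 * p.2) + m : ℤ))

variable [IsTopologicalRing R] [T2Space R]

theorem tendsto_qInv_mul_qInv (hq : small q) (m : ℕ) (k : ℤ) :
    Tendsto (fun n : ℕ => qInv q (n - 2 * (2 * k)) * qInv q (n + 2 * (2 * k) + m)) atTop
      (𝓝 (Ring.inverse (qPochInf q q) * Ring.inverse (qPochInf q q))) := by
  simp only [sub_eq_add_neg, add_assoc]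
  exact (tendsto_qInv hq _).mul (tendsto_qInv hq _)

/-- All pairs involved are relative to `a = q^{4ε}`; `ε = 0` and `ε = 1` give the first and second
identities. -/
theorem hasSum_mod_sixty (hq : small q) {ε i j : ℕ} (hε : ε ≤ 1) (hi : i = 28 + 28 * ε)
    (hj : j + 28 * ε = 32) :
    HasSum (fun p : ℕ × ℕ => q ^ (p.1 ^ 2 + 2 * p.2 ^ 2 + 4 * ε * p.1 + 4 * ε * p.2) *
        Ring.inverse (qPoch q (q ^ 2) (p.1 + 2 * ε) * qPoch (q ^ 2) (q ^ 2) p.2 *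
          qPoch (q ^ 2) (q ^ 4) (p.2 + ε)) * qPochInvSub q q p.1 (2 * p.2))
      (qPochInf (q ^ i) (q ^ 60) * qPochInf (q ^ j) (q ^ 60) * qPochInf (q ^ 60) (q ^ 60) *
        Ring.inverse (qPochInf q q)) := by
  have key := hasSum_double hq hq (i := i) (j := j) (by omega) (by omega)
    (e := fun p => p.1 ^ 2 + 2 * p.2 ^ 2 + 4 * ε * p.1 + 4 * ε * p.2)
    (fun p => by nlinarith [Nat.le_self_pow two_ne_zero p.1, Nat.le_self_pow two_ne_zero p.2])
    (bdd_coeff hq (2 * ε) ε)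
    (fun n r h => by
      rw [qInv_of_neg q (k := ((n, r).1 : ℤ) - 2 * (n, r).2) (by dsimp only; omega), mul_zero])
    (bdd_qInv_mul_qInv hq (2 * (2 * ε)))
    (tendsto_qInv_mul_qInv hq (2 * (2 * ε)))
    (fun N => by
      refine (hq.qUnits.hasSum_lift (s := fun k => 2 * (2 * k)) (fun k => by push_cast; omega)
        (hq.qUnits.hasSum_lift_lift_one hε) N).congr_of_eq (fun k => ?_) ?_
      · rw [← thetaTerm_one_mul_pow q hi hj]
      · refine Finset.sum_congr rfl fun n _ => ?_
        rw [Finset.mul_sum, Finset.mul_sum, Finset.sum_mul]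
        exact Finset.sum_congr rfl fun r _ => by ring)
  obtain ⟨hP, -⟩ := tendsto_inverse_qPoch hq
  rw [show i + j = 60 by omega] at key
  refine key.congr_of_eq (fun p => ?_) ?_
  · rw [Ring.mul_inverse_rev, Ring.mul_inverse_rev, qPochInvSub_eq_qInv, qInv_natCast, ← pow_mul]
    push_cast
    ring_nf
  · linear_combination (-qPochInf (q ^ i) (q ^ 60) * qPochInf (q ^ j) (q ^ 60) *
      qPochInf (q ^ 60) (q ^ 60) * Ring.inverse (qPochInf q q)) * hP

theorem hasSum_mod_sixty_zero (hq : small q) :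
    HasSum (fun p : ℕ × ℕ => q ^ (p.1 ^ 2 + 2 * p.2 ^ 2) *
        Ring.inverse (qPoch q (q ^ 2) p.1 * qPoch (q ^ 2) (q ^ 2) p.2 *
          qPoch (q ^ 2) (q ^ 4) p.2) * qPochInvSub q q p.1 (2 * p.2))
      (qPochInf (q ^ 28) (q ^ 60) * qPochInf (q ^ 32) (q ^ 60) * qPochInf (q ^ 60) (q ^ 60) *
        Ring.inverse (qPochInf q q)) := by
  simpa only [mul_zero, zero_mul, add_zero] using
    hasSum_mod_sixty hq (ε := 0) (i := 28) (j := 32) zero_le_one rfl rfl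

theorem hasSum_mod_sixty_one (hq : small q) :
    HasSum (fun p : ℕ × ℕ => q ^ (p.1 ^ 2 + 2 * p.2 ^ 2 + 4 * p.1 + 4 * p.2) *
        Ring.inverse (qPoch q (q ^ 2) (p.1 + 2) * qPoch (q ^ 2) (q ^ 2) p.2 *
          qPoch (q ^ 2) (q ^ 4) (p.2 + 1)) * qPochInvSub q q p.1 (2 * p.2))
      (qPochInf (q ^ 4) (q ^ 60) * qPochInf (q ^ 56) (q ^ 60) * qPochInf (q ^ 60) (q ^ 60) *
        Ring.inverse (qPochInf q q)) := by
  simpa only [mul_one, mul_comm (qPochInf (q ^ 4) (q ^ 60))] using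
    hasSum_mod_sixty hq (ε := 1) (i := 56) (j := 4) le_rfl rfl rfl

theorem hasSum_mod_eighty_eight (hq : small q) :
    HasSum (fun p : ℕ × ℕ => q ^ (p.1 ^ 2 + 4 * p.2 ^ 2) * qPoch (-q) (q ^ 2) p.1 *
        Ring.inverse (qPoch (q ^ 2) (q ^ 4) p.1 * qPoch (q ^ 4) (q ^ 4) p.2 *
          qPoch (q ^ 4) (q ^ 8) p.2) * qPochInvSub (q ^ 2) (q ^ 2) p.1 (2 * p.2))
      (qPochInf (q ^ 40) (q ^ 88) * qPochInf (q ^ 48) (q ^ 88) * qPochInf (q ^ 88) (q ^ 88) *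
        qPochInf (-q) (q ^ 2) * Ring.inverse (qPochInf (q ^ 2) (q ^ 2))) := by
  have hq2 := small_pow hq two_pos
  have key := hasSum_double hq hq2 (i := 40) (j := 48) (by omega) (by omega)
    (e := fun p => p.1 ^ 2 + 4 * p.2 ^ 2)
    (fun p => by nlinarith [Nat.le_self_pow two_ne_zero p.1, Nat.le_self_pow two_ne_zero p.2])
    (((bdd_qPoch hq2 (-q)).comp fun p : ℕ × ℕ => p.1).mul (bdd_coeff hq2 0 0))
    (fun n r h => by
      rw [qInv_of_neg (q ^ 2) (k := ((n, r).1 : ℤ) - 2 * (n, r).2) (by dsimp only; omega),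
        mul_zero, mul_zero])
    (((bdd_qPoch hq2 (-q)).comp fun p : ℕ × ℤ => p.1).mul (bdd_qInv_mul_qInv hq2 0))
    (fun k => (tendsto_qPoch hq2 (-q)).mul (tendsto_qInv_mul_qInv hq2 0 k))
    (fun N => by
      refine (hq.qUnits.hasSum_lift_neg (s := fun k => 2 * (2 * k))
        (fun n => (hq2.qUnits.hasSum_lift_lift_one zero_le_one n).congr_of_eq
          (fun k => by simp only [mul_zero, Nat.cast_zero, add_zero]; rfl) rfl)
        N).congr_of_eq (fun k => ?_) ?_
      · simp only [Nat.cast_zero, add_zero]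
        congr 1
        -- The exponents add up to `4k(k-1) + 8k² + 16k² + 16k² = 44k² - 4k`, whence `40` and `48`.
        have h1 : 8 * triangle (-k) + 8 * (k * k).toNat + 4 * (2 * k * (2 * k)).toNat +
            ((2 * (2 * k)) ^ 2).toNat = 40 * triangle k + 48 * triangle (-k) := by
          zify
          rw [Int.toNat_of_nonneg (mul_self_nonneg _), Int.toNat_of_nonneg (mul_self_nonneg _),
            Int.toNat_of_nonneg (sq_nonneg _)]
          linear_combination (-20) * triangle_mul_two k - 20 * triangle_mul_two (-k)
        rw [thetaTerm_pow, ← h1, thetaTerm]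
        ring
      · refine Finset.sum_congr rfl fun n _ => ?_
        rw [Finset.mul_sum, Finset.mul_sum, Finset.sum_mul]
        exact Finset.sum_congr rfl fun r _ => by ring_nf)
  obtain ⟨hP, -⟩ := tendsto_inverse_qPoch hq2
  refine key.congr_of_eq (fun p => ?_) ?_
  · rw [Ring.mul_inverse_rev, Ring.mul_inverse_rev, qPochInvSub_eq_qInv, qInv_natCast, ← pow_mul,
      ← pow_mul]
    push_cast
    ring_nf
  · linear_combination (-qPochInf (q ^ 40) (q ^ 88) * qPochInf (q ^ 48) (q ^ 88) *
      qPochInf (q ^ 88) (q ^ 88) * qPochInf (-q) (q ^ 2) *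
      Ring.inverse (qPochInf (q ^ 2) (q ^ 2))) * hP

end QSeriesRing

end Identities

/-! ### The two rings: ℂ with `‖q‖ < 1`, and ℤ⟦X⟧ with zero constant coefficient. -/

section Instances

open Filter Topology

theorem summable_norm_mul_pow {q : ℂ} (hq : ‖q‖ < 1) (a : ℂ) :
    Summable fun j : ℕ => ‖-(a * q ^ j)‖ := by
  simp only [norm_neg, norm_mul, norm_pow]
  exact (summable_geometric_of_lt_one (norm_nonneg q) hq).mul_left _

theorem Complex.one_sub_ne_zero_of_norm_lt_one {q : ℂ} (hq : ‖q‖ < 1) : 1 - q ≠ 0 := by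
  intro h
  rw [← sub_eq_zero.mp h, norm_one] at hq
  exact lt_irrefl _ hq

theorem Complex.multipliable_one_sub_mul_pow {q : ℂ} (hq : ‖q‖ < 1) (a : ℂ) :
    Multipliable fun j : ℕ => 1 - a * q ^ j := by
  simpa only [sub_eq_add_neg] using multipliable_one_add_of_summable (summable_norm_mul_pow hq a)

theorem Complex.qPochInf_self_ne_zero {q : ℂ} (hq : ‖q‖ < 1) : qPochInf q q ≠ 0 := by
  simp only [qPochInf, sub_eq_add_neg]
  refine tprod_one_add_ne_zero_of_summable (fun j => ?_) (summable_norm_mul_pow hq q)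
  rw [← sub_eq_add_neg, ← pow_succ']
  refine Complex.one_sub_ne_zero_of_norm_lt_one ?_
  rw [norm_pow]
  exact pow_lt_one₀ (norm_nonneg q) hq j.succ_ne_zero

noncomputable instance Complex.instQSeriesRing : QSeriesRing ℂ where
  small q := ‖q‖ < 1
  size a := ‖a‖
  size_nonneg := norm_nonneg
  size_mul_le := norm_mul_le
  exists_size_le_of_tendsto hf := by
    obtain ⟨C, hC⟩ := hf.norm.bddAbove_range
    exact ⟨C, fun n => hC ⟨n, rfl⟩⟩
  small_pow {q} hq k hk := by
    rw [norm_pow]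
    exact pow_lt_one₀ (norm_nonneg q) hq hk.ne'
  isUnit_one_sub hq := (Complex.one_sub_ne_zero_of_norm_lt_one hq).isUnit
  multipliable hq a := Complex.multipliable_one_sub_mul_pow hq a
  tendsto_inverse {q} hq := by
    refine ⟨(qPochInf q q)⁻¹, ?_⟩
    simp only [Ring.inverse_eq_inv']
    exact ((Complex.multipliable_one_sub_mul_pow hq q).hasProd.tendsto_prod_nat).inv₀
      (Complex.qPochInf_self_ne_zero hq)
  tannery {ι q} hq {e} he {b c} hb hc {x} hx := by
    obtain ⟨C, hC⟩ := hb
    have hs := (he ‖q‖ (norm_nonneg q) hq).mul_right C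
    have hbound : ∀ n i, ‖q ^ e i * b n i‖ ≤ ‖q‖ ^ e i * C := fun n i => by
      rw [norm_mul, norm_pow]
      exact mul_le_mul_of_nonneg_left (hC n i) (by positivity)
    have hlim : ∀ i, Tendsto (fun n => q ^ e i * b n i) atTop (𝓝 (q ^ e i * c i)) :=
      fun i => (hc i).const_mul _
    refine ⟨∑' i, q ^ e i * c i, ?_, ?_⟩
    · rw [show x = fun n => ∑' i, q ^ e i * b n i from funext fun n => (hx n).tsum_eq.symm]
      exact tendsto_tsum_of_dominated_convergence hs hlim (Eventually.of_forall hbound)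
    · exact (hs.of_norm_bounded fun i =>
        le_of_tendsto (hlim i).norm (Eventually.of_forall fun n => hbound n i)).hasSum

theorem PowerSeries.coeff_pow_mul_of_lt {q : ℤ⟦X⟧} (hq : q.constantCoeff = 0) {d n : ℕ}
    (h : d < n) (f : ℤ⟦X⟧) : (q ^ n * f).coeff d = 0 := by
  refine PowerSeries.X_pow_dvd_iff.mp ?_ d h
  exact (pow_dvd_pow_of_dvd (PowerSeries.X_dvd_iff.mpr hq) n).mul_right f

theorem PowerSeries.isUnit_one_sub_of_constantCoeff {q : ℤ⟦X⟧} (hq : q.constantCoeff = 0) :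
    IsUnit (1 - q) := by
  rw [PowerSeries.isUnit_iff_constantCoeff]
  simp [hq]

theorem PowerSeries.constantCoeff_pow_eq_zero {q : ℤ⟦X⟧} (hq : q.constantCoeff = 0) {k : ℕ}
    (hk : 0 < k) : (q ^ k).constantCoeff = 0 := by
  rw [map_pow, hq, zero_pow hk.ne']

theorem PowerSeries.multipliable_one_sub_mul_pow {q : ℤ⟦X⟧} (hq : q.constantCoeff = 0)
    (a : ℤ⟦X⟧) : Multipliable fun j : ℕ => 1 - a * q ^ j := by
  simp only [sub_eq_add_neg]
  apply PowerSeries.WithPiTopology.multipliable_one_add_of_tendsto_order_atTop_nhds_top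
  rw [ENat.tendsto_nhds_top_iff_natCast_lt]
  intro n
  filter_upwards [eventually_gt_atTop n] with j hj
  refine lt_of_lt_of_le (Nat.cast_lt.mpr hj) (PowerSeries.nat_le_order _ _ fun d hd => ?_)
  rw [map_neg, mul_comm, PowerSeries.coeff_pow_mul_of_lt hq hd, neg_zero]

/-- The `d`-th coefficient is constant for `n ≥ d`, since `1/(q;q)_n` and `1/(q;q)_{n+1}` differ by
a multiple of `q^{n+1}`. -/
theorem PowerSeries.tendsto_inverse_qPoch {q : ℤ⟦X⟧} (hq : q.constantCoeff = 0) :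
    ∃ L, Tendsto (fun n => Ring.inverse (qPoch q q n)) atTop (𝓝 L) := by
  have hu : QUnits q := fun k hk =>
    PowerSeries.isUnit_one_sub_of_constantCoeff (PowerSeries.constantCoeff_pow_eq_zero hq hk)
  refine ⟨PowerSeries.mk fun d => (Ring.inverse (qPoch q q d)).coeff d, ?_⟩
  rw [PowerSeries.WithPiTopology.tendsto_iff_coeff_tendsto]
  intro d
  rw [PowerSeries.coeff_mk]
  refine tendsto_const_nhds.congr' ?_
  filter_upwards [eventually_ge_atTop d] with n hn
  induction n, hn using Nat.le_induction with
  | base => rfl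
  | succ n hn ih =>
    have h := hu.qInv_pred (n + 1) (k := (n + 1 : ℕ)) rfl
    rw [Nat.cast_succ, add_sub_cancel_right, ← Nat.cast_succ, qInv_natCast, qInv_natCast] at h
    rw [ih, h, sub_mul, one_mul, map_sub, PowerSeries.coeff_pow_mul_of_lt hq (by omega), sub_zero]

noncomputable instance PowerSeries.instQSeriesRing : QSeriesRing ℤ⟦X⟧ where
  small q := q.constantCoeff = 0
  -- Coefficientwise convergence needs no domination, so boundedness is made vacuous.
  size _ := 0
  size_nonneg _ := le_rfl
  size_mul_le _ _ := by simp
  exists_size_le_of_tendsto _ := ⟨0, fun _ => le_rfl⟩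
  small_pow hq _ hk := PowerSeries.constantCoeff_pow_eq_zero hq hk
  isUnit_one_sub hq := PowerSeries.isUnit_one_sub_of_constantCoeff hq
  multipliable hq a := PowerSeries.multipliable_one_sub_mul_pow hq a
  tendsto_inverse hq := PowerSeries.tendsto_inverse_qPoch hq
  tannery {ι q} hq {e} he {b c} _ hc {x} hx := by
    -- Summability at `r = 1/2` already forces `e` to tend to infinity, so only finitely many
    -- indices affect a given coefficient.
    have hfin : ∀ d : ℕ, {i | e i ≤ d}.Finite := fun d => by
      have h := (he (1 / 2) (by norm_num) (by norm_num)).tendsto_cofinite_zero.eventually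
        (gt_mem_nhds (show (0 : ℝ) < (1 / 2) ^ d by positivity))
      refine (eventually_cofinite.mp h).subset fun i hi => ?_
      exact not_lt.mpr (pow_le_pow_of_le_one (by norm_num) (by norm_num) hi)
    have hsum : ∀ (f : ι → ℤ⟦X⟧) (d : ℕ), HasSum (fun i => (q ^ e i * f i).coeff d)
        (∑ i ∈ (hfin d).toFinset, (q ^ e i * f i).coeff d) := fun f d =>
      hasSum_sum_of_ne_finset_zero fun i hi =>
        PowerSeries.coeff_pow_mul_of_lt hq (by simpa using hi) _
    refine ⟨PowerSeries.mk fun d => ∑ i ∈ (hfin d).toFinset, (q ^ e i * c i).coeff d, ?_, ?_⟩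
    · rw [PowerSeries.WithPiTopology.tendsto_iff_coeff_tendsto]
      intro d
      have hx' : ∀ n, (x n).coeff d = ∑ i ∈ (hfin d).toFinset, (q ^ e i * b n i).coeff d :=
        fun n => ((PowerSeries.WithPiTopology.hasSum_iff_hasSum_coeff ℤ).mp (hx n) d).unique
          (hsum (b n) d)
      simp only [hx', PowerSeries.coeff_mk]
      exact tendsto_finsetSum _ fun i _ =>
        ((PowerSeries.WithPiTopology.continuous_coeff ℤ d).tendsto _).comp ((hc i).const_mul _)
    · rw [PowerSeries.WithPiTopology.hasSum_iff_hasSum_coeff]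
      intro d
      rw [PowerSeries.coeff_mk]
      exact hsum c d

end Instances

theorem mainTheorem6 :
    -- the identities of analytic functions on the open unit disc
    (∀ q : ℂ, ‖q‖ < 1 →
      HasSum
        (fun p : ℕ × ℕ => q ^ (p.1 ^ 2 + 2 * p.2 ^ 2)
          / (qPoch q (q ^ 2) p.1 * qPoch (q ^ 2) (q ^ 2) p.2 * qPoch (q ^ 2) (q ^ 4) p.2)
          * qPochInvSub q q p.1 (2 * p.2))
        (qPochInf (q ^ 28) (q ^ 60) * qPochInf (q ^ 32) (q ^ 60) * qPochInf (q ^ 60) (q ^ 60)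
          / qPochInf q q) ∧
      HasSum
        (fun p : ℕ × ℕ => q ^ (p.1 ^ 2 + 2 * p.2 ^ 2 + 4 * p.1 + 4 * p.2)
          / (qPoch q (q ^ 2) (p.1 + 2) * qPoch (q ^ 2) (q ^ 2) p.2
            * qPoch (q ^ 2) (q ^ 4) (p.2 + 1))
          * qPochInvSub q q p.1 (2 * p.2))
        (qPochInf (q ^ 4) (q ^ 60) * qPochInf (q ^ 56) (q ^ 60) * qPochInf (q ^ 60) (q ^ 60)
          / qPochInf q q) ∧
      HasSum
        (fun p : ℕ × ℕ => q ^ (p.1 ^ 2 + 4 * p.2 ^ 2) * qPoch (-q) (q ^ 2) p.1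
          / (qPoch (q ^ 2) (q ^ 4) p.1 * qPoch (q ^ 4) (q ^ 4) p.2 * qPoch (q ^ 4) (q ^ 8) p.2)
          * qPochInvSub (q ^ 2) (q ^ 2) p.1 (2 * p.2))
        (qPochInf (q ^ 40) (q ^ 88) * qPochInf (q ^ 48) (q ^ 88) * qPochInf (q ^ 88) (q ^ 88)
          * qPochInf (-q) (q ^ 2) / qPochInf (q ^ 2) (q ^ 2))) ∧
    -- the identities of formal power series
    (∀ q : ℤ⟦X⟧, q = PowerSeries.X →
      HasSum
        (fun p : ℕ × ℕ => q ^ (p.1 ^ 2 + 2 * p.2 ^ 2)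
          * Ring.inverse
            (qPoch q (q ^ 2) p.1 * qPoch (q ^ 2) (q ^ 2) p.2 * qPoch (q ^ 2) (q ^ 4) p.2)
          * qPochInvSub q q p.1 (2 * p.2))
        (qPochInf (q ^ 28) (q ^ 60) * qPochInf (q ^ 32) (q ^ 60) * qPochInf (q ^ 60) (q ^ 60)
          * Ring.inverse (qPochInf q q)) ∧
      HasSum
        (fun p : ℕ × ℕ => q ^ (p.1 ^ 2 + 2 * p.2 ^ 2 + 4 * p.1 + 4 * p.2)
          * Ring.inverse
            (qPoch q (q ^ 2) (p.1 + 2) * qPoch (q ^ 2) (q ^ 2) p.2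
              * qPoch (q ^ 2) (q ^ 4) (p.2 + 1))
          * qPochInvSub q q p.1 (2 * p.2))
        (qPochInf (q ^ 4) (q ^ 60) * qPochInf (q ^ 56) (q ^ 60) * qPochInf (q ^ 60) (q ^ 60)
          * Ring.inverse (qPochInf q q)) ∧
      HasSum
        (fun p : ℕ × ℕ => q ^ (p.1 ^ 2 + 4 * p.2 ^ 2) * qPoch (-q) (q ^ 2) p.1
          * Ring.inverse
            (qPoch (q ^ 2) (q ^ 4) p.1 * qPoch (q ^ 4) (q ^ 4) p.2 * qPoch (q ^ 4) (q ^ 8) p.2)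
          * qPochInvSub (q ^ 2) (q ^ 2) p.1 (2 * p.2))
        (qPochInf (q ^ 40) (q ^ 88) * qPochInf (q ^ 48) (q ^ 88) * qPochInf (q ^ 88) (q ^ 88)
          * qPochInf (-q) (q ^ 2) * Ring.inverse (qPochInf (q ^ 2) (q ^ 2)))) := by
  refine ⟨fun q hq => ?_, fun q hq => ?_⟩
  · have hq' : QSeriesRing.small q := hq
    simp only [div_eq_mul_inv, ← Ring.inverse_eq_inv']
    exact ⟨QSeriesRing.hasSum_mod_sixty_zero hq', QSeriesRing.hasSum_mod_sixty_one hq',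
      QSeriesRing.hasSum_mod_eighty_eight hq'⟩
  · have hq' : QSeriesRing.small q := by
      rw [hq]
      exact PowerSeries.constantCoeff_X
    exact ⟨QSeriesRing.hasSum_mod_sixty_zero hq', QSeriesRing.hasSum_mod_sixty_one hq',
      QSeriesRing.hasSum_mod_eighty_eight hq'⟩
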